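/- **Proposition (Conditional dSMC).** Let $\mathcal X$ be a measurable space and $T\in\mathbb N$. For $1\le t\le T$ let $P_t(dx_t\mid x_{t-1})$ be Markov kernels on $\mathcal X$ and $h_t:\mathcal X\to[0,\infty)$ measurable potentials; for $0\le t\le T$ let $\nu_t$ be probability measures on $\mathcal X$ such that $P_t(\cdot\mid x)\ll\nu_t$ for all $t\ge1$ and all $x\in\mathcal X$. For $0\le a\le b\le T$ the partial smoothing distribution is $$\mathbb Q_{a:b}(dx_{a:b})=\frac1{L_{a:b}}\,\nu_a(dx_a)\prod_{t=a+1}^bP_t(dx_t\mid x_{t-1})\prod_{t=a+1}^bh_t(x_t),$$ where $L_{a:b}$ is the normalizing constant. For $1\le t\le T$ let $\omega_t:\mathcal X\times\mathcal X\to[0,\infty)$ be a jointly measurable function such that, for every $x\in\mathcal X$, $\omega_t(x,\cdot)$ is a version of the Radon–Nikodym derivative $P_t(dy\mid x)h_t(y)/\nu_t(dy)$. For $0\le t\le T$ let $q_t$ be a proposal probability measure with $\nu_t\ll q_t$, and let $w_t:\mathcal X\to[0,\infty)$ be a measurable version of $d\nu_t/dq_t$ (for instance $q_t=\nu_t$,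 $w_t=1$). Let $N\ge1$. Fix an ordered binary tree on $\{a,\dots,b\}$: its leaves are $\{a\},\dots,\{b\}$, and every node that is not a leaf is an interval $\{a',\dots,b'\}$ with children $\{a',\dots,c'-1\}$ and $\{c',\dots,b'\}$ for some $a'<c'\le b'$. The dSMC algorithm with $N$ particles on this tree is defined recursively. Throughout, normalized weights are taken to be uniform if all the weights to be normalized vanish. * At a leaf $\{k\}$, draw $x_k^1,\dots,x_k^N$ independently from $q_k$. Put $\sigma^n_{k:k}(k)=n$ and $L^N_{k:k}=\frac1N\sum_nw_k(x_k^n)$, and give the $n$-th particle the weight $w^n=w_k(x_k^n)/\sum_mw_k(x_k^m)$. * At a node $\{a',\dots,b'\}$ split at $c'$, run the algorithm independently on the two children. Let $w^m_{\mathrm{left}}$, $w^n_{\mathrm{right}}$ be the normalized weights they return, and set $$U^{m,n}=w^m_{\mathrm{left}}\,w^n_{\mathrm{right}}\;\omega_{c'}\Big(x_{c'-1}^{\sigma^m_{a':c'-1}(c'-1)},\,x_{c'}^{\sigma^n_{c':b'}(c')}\Big),\qquad W_{c'}^{m,n}=\frac{U^{m,n}}{\sum_{i,j}U^{i,j}},\qquad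 L^N_{a':b'}=L^N_{a':c'-1}\,L^N_{c':b'}\sum_{i,j=1}^NU^{i,j}.$$ Draw $N$ index pairs $(l^n_{c'},r^n_{c'})$ independently from the matrix $W_{c'}$. Put $\sigma^n_{a':b'}(k)=\sigma^{l^n_{c'}}_{a':c'-1}(k)$ for $k<c'$ and $\sigma^n_{a':b'}(k)=\sigma^{r^n_{c'}}_{c':b'}(k)$ for $k\ge c'$. The returned weights are $1/N$. Let $0\le a<c\le b\le T$, suppose that the root $\{a,\dots,b\}$ of the tree is split at $c$, and suppose that $0<L_{a:b}<\infty$. Let $\psi_{a:b}$ be the law of all the variables so generated except the index pairs $(l_c^n,r_c^n)_{n}$ of the root (that is, the product of the laws of all the variables generated on the two children of the root), and let $\pi_{a:b}=\frac{L^N_{a:b}}{L_{a:b}}\,\psi_{a:b}$. Then $\pi_{a:b}$ and $\mathbb Q_{a:b}$ are probability measures. Moreover, let the variables have law $\pi_{a:b}$, let $(I,J)$ be drawn, given these variables, from the root weight matrix $W_c$, and define the star trajectory $X^*_{a:b}$ by $$X^*_k=x_k^{\sigma^I_{a:c-1}(k)}\quad(a\le k<c),\qquad X^*_k=x_k^{\sigma^J_{c:b}(k)}\quad(c\le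 k\le b).$$ Then the marginal law of $X^*_{a:b}$ is $\mathbb Q_{a:b}$. -/

import Mathlib

open MeasureTheory ProbabilityTheory
open scoped ENNReal NNReal

noncomputable section

namespace DSMC

/-- A Feynman-Kac model on the state space `X` with times `0, …, T`: transition kernels
`P t (x_{t-1}, dx_t)` (used for `1 ≤ t ≤ T`), potentials `h t`, and auxiliary probability measures
`ν t` that dominate the transition kernels. -/
structure Model (X : Type*) [MeasurableSpace X] (T : ℕ) where
  P : ℕ → Kernel X X
  markov_P : ∀ t, IsMarkovKernel (P t)
  h : ℕ → X → ℝ≥0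
  measurable_h : ∀ t, Measurable (h t)
  ν : ℕ → Measure X
  prob_ν : ∀ t, IsProbabilityMeasure (ν t)
  ac : ∀ t, 0 < t → t ≤ T → ∀ x, P t x ≪ ν t

/-- Trajectories `x_{a:b}`. -/
abbrev Path (X : Type*) (a b : ℕ) : Type _ := Set.Icc a b → X

section PartialSmoothing

variable {X : Type*} [MeasurableSpace X] {T : ℕ} (M : Model X T)

/-- Appends the state `x_{b+1}` to the trajectory `x_{a:b}`. -/
def appendState {a b : ℕ} (p : Path X a b × X) : Path X a (b + 1) :=
  fun k => if hk : (k : ℕ) ≤ b then p.1 ⟨k, k.2.1, hk⟩ else p.2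

/-- The law `ν_a(dx_a) ∏_{t=a+1}^b P_t(dx_t | x_{t-1})` on trajectories `x_{a:b}`, for `a ≤ b`
(for `b < a` the value is irrelevant). -/
def markovLaw (a : ℕ) : (b : ℕ) → Measure (Path X a b)
  | 0 => (M.ν a).map fun x _ => x
  | b + 1 =>
    if hab : a ≤ b then
      (markovLaw a b ⊗ₘ (M.P (b + 1)).comap (fun x : Path X a b => x ⟨b, hab, le_rfl⟩)
        (measurable_pi_apply _)).map appendState
    else (M.ν a).map fun x _ => x

/-- The unnormalized partial smoothing measure
`ν_a(dx_a) ∏_{t=a+1}^b P_t(dx_t | x_{t-1}) ∏_{t=a+1}^b h_t(x_t)`. -/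
def unnormSmoothing (a b : ℕ) : Measure (Path X a b) :=
  (markovLaw M a b).withDensity fun x =>
    ∏ k : Set.Icc a b, if a < (k : ℕ) then (M.h k (x k) : ℝ≥0∞) else 1

/-- The normalizing constant `L_{a:b}`. -/
def normConst (a b : ℕ) : ℝ≥0∞ := unnormSmoothing M a b Set.univ

/-- The partial smoothing distribution `Q_{a:b}`. -/
def smoothing (a b : ℕ) : Measure (Path X a b) :=
  (normConst M a b)⁻¹ • unnormSmoothing M a b

end PartialSmoothing

/-- What the sampler uses on top of the model: proposals `q t` with `ν t ≪ q t`, a measurable version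
`w t` of the importance weight `dν_t / dq_t`, and a jointly measurable version `ω t` of the
Radon-Nikodym derivative `P_t(dx_t | x_{t-1}) h_t(x_t) / ν_t(dx_t)`, for `1 ≤ t ≤ T`.
The case `q t = ν t`, `w t = 1` is that of equally weighted initial particles. -/
structure Sampler {X : Type*} [MeasurableSpace X] {T : ℕ} (M : Model X T) where
  q : ℕ → Measure X
  prob_q : ∀ t, IsProbabilityMeasure (q t)
  ac : ∀ t, t ≤ T → M.ν t ≪ q t
  w : ℕ → X → ℝ≥0
  measurable_w : ∀ t, Measurable (w t)
  w_ae : ∀ t, t ≤ T → (fun x => (w t x : ℝ≥0∞)) =ᵐ[q t] (M.ν t).rnDeriv (q t)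
  ω : ℕ → X → X → ℝ≥0
  measurable_ω : ∀ t, Measurable (Function.uncurry (ω t))
  ω_ae : ∀ t, 0 < t → t ≤ T → ∀ x, (fun y => (ω t x y : ℝ≥0∞)) =ᵐ[M.ν t]
    ((M.P t x).withDensity fun y => (M.h t y : ℝ≥0∞)).rnDeriv (M.ν t)

/-- Ordered binary trees on `{a, …, b}`: a node splits `{a, …, b}` into `{a, …, c}` and
`{c + 1, …, b}`. -/
inductive SplitTree : ℕ → ℕ → Type
  | leaf (a : ℕ) : SplitTree a a
  | node {a c b : ℕ} (l : SplitTree a c) (r : SplitTree (c + 1) b) : SplitTree a b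

theorem SplitTree.le {a b : ℕ} (t : SplitTree a b) : a ≤ b := by
  induction t with
  | leaf a => exact le_rfl
  | node l r hl hr => omega

/-- Normalizes weights to sum to one; if they all vanish the uniform weights are used. -/
def normalizeWeights {ι : Type*} [Fintype ι] (u : ι → ℝ≥0) (i : ι) : ℝ≥0 :=
  if ∑ j, u j = 0 then (Fintype.card ι : ℝ≥0)⁻¹ else u i / ∑ j, u j

section Algorithm

variable (X : Type*) (N : ℕ)

/-- The values of all random variables generated by dSMC on the tree: at each leaf the `N` particles
sampled there, at each node the `N` pairs of resampling indices `(l^n, r^n)` generated there. -/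
def Vars : {a b : ℕ} → SplitTree a b → Type _
  | _, _, .leaf _ => Fin N → X
  | _, _, .node l r => (Vars l × Vars r) × (Fin N → Fin N × Fin N)

instance Vars.instMeasurableSpace [MeasurableSpace X] :
    {a b : ℕ} → (t : SplitTree a b) → MeasurableSpace (Vars X N t)
  | _, _, .leaf _ => inferInstanceAs (MeasurableSpace (Fin N → X))
  | _, _, .node l r =>
    letI := Vars.instMeasurableSpace l
    letI := Vars.instMeasurableSpace r
    inferInstanceAs (MeasurableSpace ((Vars X N l × Vars X N r) × (Fin N → Fin N × Fin N)))

variable {X N}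

/-- The particle `x_k^n` sampled at the leaf `k`. -/
def particle : {a b : ℕ} → (t : SplitTree a b) → Vars X N t → Set.Icc a b → Fin N → X
  | _, _, .leaf _, v, _, n => v n
  | _, _, .node (c := c) l r, v, k, n =>
    if hk : (k : ℕ) ≤ c then particle l v.1.1 ⟨k, k.2.1, hk⟩ n
    else particle r v.1.2 ⟨k, not_le.1 hk, k.2.2⟩ n

/-- The resampled index `σ^n_{a:b}(k)`. -/
def sigma : {a b : ℕ} → (t : SplitTree a b) → Vars X N t → Fin N → Set.Icc a b → Fin N
  | _, _, .leaf _, _, n, _ => n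
  | _, _, .node (c := c) l r, v, n, k =>
    if hk : (k : ℕ) ≤ c then sigma l v.1.1 (v.2 n).1 ⟨k, k.2.1, hk⟩
    else sigma r v.1.2 (v.2 n).2 ⟨k, not_le.1 hk, k.2.2⟩

/-- The state at time `k` of the `n`-th trajectory returned by dSMC, `x_k^{σ^n_{a:b}(k)}`. -/
def traj {a b : ℕ} (t : SplitTree a b) (v : Vars X N t) (n : Fin N) : Path X a b :=
  fun k => particle t v k (sigma t v n k)

variable [MeasurableSpace X] {T : ℕ} {M : Model X T} (S : Sampler M)

/-- The normalized weights of the trajectories returned by dSMC: importance weights at a leaf, `1/N`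
after a resampling step. -/
def weight : {a b : ℕ} → (t : SplitTree a b) → Vars X N t → Fin N → ℝ≥0
  | _, _, .leaf k, v, n => normalizeWeights (fun m => S.w k (v m)) n
  | _, _, .node _ _, _, _ => (N : ℝ≥0)⁻¹

/-- The unnormalized entries of the weight matrix for stitching at `c + 1`:
`w^m_c w^n_{c+1} ω_{c+1}(x_c^{σ^m_{a:c}(c)}, x_{c+1}^{σ^n_{c+1:b}(c+1)})`. -/
def stitchWeight {a c b : ℕ} (l : SplitTree a c) (r : SplitTree (c + 1) b) (v : Vars X N l × Vars X N r)
    (mn : Fin N × Fin N) : ℝ≥0 :=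
  weight S l v.1 mn.1 * weight S r v.2 mn.2 *
    S.ω (c + 1) (traj l v.1 mn.1 ⟨c, l.le, le_rfl⟩) (traj r v.2 mn.2 ⟨c + 1, le_rfl, r.le⟩)

/-- The weight matrix `W_{c+1}^{m,n}`. -/
def weightMatrix {a c b : ℕ} (l : SplitTree a c) (r : SplitTree (c + 1) b) (v : Vars X N l × Vars X N r) :
    Fin N × Fin N → ℝ≥0 :=
  normalizeWeights (stitchWeight S l r v)

/-- The law `ψ_{a:b}` of all random variables generated by dSMC: independent particles
`x_k^n ~ q_k` at the leaves; at a node the index pairs have, given everything generated in the two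
subtrees, the (multinomial) probability mass function `∏_n W^{l^n, r^n}`. -/
def psi : {a b : ℕ} → (t : SplitTree a b) → Measure (Vars X N t)
  | _, _, .leaf k => Measure.pi fun _ : Fin N => S.q k
  | _, _, .node l r =>
    (((psi l).prod (psi r)).prod (Measure.count : Measure (Fin N → Fin N × Fin N))).withDensity
      fun v => ∏ n, (weightMatrix S l r v.1 (v.2 n) : ℝ≥0∞)

/-- The estimate `L^N_{a:b}` of the normalizing constant. -/
def normEst : {a b : ℕ} → (t : SplitTree a b) → Vars X N t → ℝ≥0
  | _, _, .leaf k, v => (N : ℝ≥0)⁻¹ * ∑ n, S.w k (v n)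
  | _, _, .node l r, v =>
    normEst l v.1.1 * normEst r v.1.2 * ∑ mn, stitchWeight S l r v.1 mn

/-- The estimate `L^N_{a:b}` for a tree with root `node l r`; it does not depend on the indices
generated at the root. -/
def rootNormEst {a c b : ℕ} (l : SplitTree a c) (r : SplitTree (c + 1) b) (v : Vars X N l × Vars X N r) :
    ℝ≥0 :=
  normEst S l v.1 * normEst S r v.2 * ∑ mn, stitchWeight S l r v mn

/-- The law `π_{a:b} = (L^N_{a:b} / L_{a:b}) ψ_{a:b}` of all variables but the index pairs of the
root, for the tree with root `node l r`. The marginal of `ψ_{a:b}` on these variables is the product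
of the laws for the two subtrees. -/
def extendedTarget (N : ℕ) {a c b : ℕ} (l : SplitTree a c) (r : SplitTree (c + 1) b) :
    Measure (Vars X N l × Vars X N r) :=
  ((psi S l).prod (psi S r)).withDensity fun v => (rootNormEst S l r v : ℝ≥0∞) / normConst M a b

/-- The joint law of the variables distributed according to `π_{a:b}` and of the pair `(I, J)`, drawn
from the weight matrix at the root. -/
def starLaw (N : ℕ) {a c b : ℕ} (l : SplitTree a c) (r : SplitTree (c + 1) b) :
    Measure ((Vars X N l × Vars X N r) × (Fin N × Fin N)) :=
  ((extendedTarget S N l r).prod (Measure.count : Measure (Fin N × Fin N))).withDensity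
    fun p => (weightMatrix S l r p.1 p.2 : ℝ≥0∞)

end Algorithm

section Star

variable {X : Type*} {N : ℕ}

/-- The star trajectory `X*_{a:b} = [X^{σ^I_{a:c}}_{a:c}, X^{σ^J_{c+1:b}}_{c+1:b}]`. -/
def starTraj {a c b : ℕ} (l : SplitTree a c) (r : SplitTree (c + 1) b)
    (p : (Vars X N l × Vars X N r) × (Fin N × Fin N)) : Path X a b :=
  fun k =>
    if hk : (k : ℕ) ≤ c then traj l p.1.1 p.2.1 ⟨k, k.2.1, hk⟩
    else traj r p.1.2 p.2.2 ⟨k, not_le.1 hk, k.2.2⟩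

end Star

end DSMC

end

open DSMC

/-!
A random weighted particle system has an intensity, the mean of its weighted empirical measure.
Intensities are multiplicative over independent systems, and multinomial resampling leaves them
unchanged. Rescaled by `L^N`, the intensity of the dSMC output therefore satisfies along the tree
the same recursion as the unnormalized smoothing measures: two adjacent ones are joined with the
density `ω_{c+1}`, because `ω_{c+1}(x, ·) ν_{c+1} = h_{c+1} P_{c+1}(· | x)`. At a leaf both are
`ν_k`, so they agree at every node. At the root, tilting `ψ` by `L^N / L` and then drawing `(I, J)`
from the normalized weights gives the star trajectory this very intensity divided by `L` as its law.
It has mass one because `Q` does, and drawing `(I, J)` preserves mass, so `π` has mass one as well.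
-/

noncomputable section

namespace DSMC

section Categorical

variable {ι κ : Type*} [Fintype ι] [Fintype κ]

theorem sum_normalizeWeights [Nonempty ι] (u : ι → ℝ≥0) : ∑ i, normalizeWeights u i = 1 := by
  unfold normalizeWeights
  split_ifs with h
  · simp
  · rw [← Finset.sum_div, div_self h]

theorem sum_mul_normalizeWeights (u : ι → ℝ≥0) (i : ι) :
    (∑ j, u j) * normalizeWeights u i = u i := by
  unfold normalizeWeights
  split_ifs with h
  · rw [h, zero_mul, Finset.sum_eq_zero_iff.1 h i (Finset.mem_univ i)]
  · rw [mul_div_cancel₀ _ h]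

theorem measurable_normalizeWeights (i : ι) :
    Measurable fun u : ι → ℝ≥0 => normalizeWeights u i := by
  have hsum : Measurable fun u : ι → ℝ≥0 => ∑ j, u j := by fun_prop
  exact Measurable.ite (hsum (measurableSet_singleton 0)) measurable_const
    ((measurable_pi_apply i).div hsum)

theorem sum_prod_mul_apply {R : Type*} [CommSemiring R] [DecidableEq κ] {W : ι → R}
    (hW : ∑ i, W i = 1) (f : ι → R) (k : κ) :
    ∑ s : κ → ι, (∏ n, W (s n)) * f (s k) = ∑ i, W i * f i := by
  calc ∑ s : κ → ι, (∏ n, W (s n)) * f (s k)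
      = ∑ s : κ → ι, ∏ n, W (s n) * if n = k then f (s n) else 1 := by
        simp only [Finset.prod_mul_distrib, Finset.prod_ite_eq', Finset.mem_univ, if_true]
    _ = ∏ n, ∑ i, W i * if n = k then f i else 1 :=
        (Fintype.prod_sum fun (n : κ) (i : ι) => W i * if n = k then f i else 1).symm
    _ = ∑ i, W i * f i := by
        rw [Fintype.prod_eq_single k fun n hn => by simp [hn, hW]]
        simp

theorem sum_prod_mul_average [DecidableEq κ] [Nonempty κ] {W : ι → ℝ≥0∞} (hW : ∑ i, W i = 1)
    (f : ι → ℝ≥0∞) :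
    ∑ s : κ → ι, (∏ n, W (s n)) * ((Fintype.card κ : ℝ≥0∞)⁻¹ * ∑ k, f (s k)) =
      ∑ i, W i * f i := by
  have hsum : ∑ s : κ → ι, (∏ n, W (s n)) * ∑ k, f (s k) = Fintype.card κ * ∑ i, W i * f i := by
    simp_rw [Finset.mul_sum (s := (Finset.univ : Finset κ))]
    rw [Finset.sum_comm]
    simp_rw [sum_prod_mul_apply hW f, Finset.sum_const, Finset.card_univ, nsmul_eq_mul]
  simp_rw [mul_left_comm _ (Fintype.card κ : ℝ≥0∞)⁻¹, ← Finset.mul_sum]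
  rw [hsum, ENNReal.inv_mul_cancel_left (by simp) (by simp)]

end Categorical

section Intensity

variable {Ω ι E F : Type*} [MeasurableSpace Ω] [MeasurableSpace ι] [MeasurableSpace E]
  [MeasurableSpace F]

theorem withDensity_map (μ : Measure Ω) {x : Ω → E} (hx : Measurable x) {f : E → ℝ≥0∞}
    (hf : Measurable f) :
    (μ.map x).withDensity f = (μ.withDensity fun u => f (x u)).map x := by
  refine Measure.ext_of_lintegral _ fun φ hφ => ?_
  rw [lintegral_withDensity_eq_lintegral_mul _ hf hφ, lintegral_map (hf.mul hφ) hx,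
    lintegral_map hφ hx, lintegral_withDensity_eq_lintegral_mul _ (by fun_prop) (by fun_prop)]
  rfl

/-- The intensity measure of a random weighted particle system: the mean of the random measure
`∑ i, g (u, i) • δ_{x (u, i)}` when `u` has law `ψ`. Integrating over the counting measure on the
set `ι` of labels turns the sum into a pushforward. -/
def intensity (ψ : Measure Ω) (g : Ω × ι → ℝ≥0∞) (x : Ω × ι → E) : Measure E :=
  ((ψ.prod Measure.count).withDensity g).map x

variable (ψ : Measure Ω) {g : Ω × ι → ℝ≥0∞} {x : Ω × ι → E}

theorem map_intensity (hx : Measurable x) {φ : E → F} (hφ : Measurable φ) :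
    (intensity ψ g x).map φ = intensity ψ g fun p => φ (x p) :=
  Measure.map_map hφ hx

theorem withDensity_intensity (hg : Measurable g) (hx : Measurable x) {φ : E → ℝ≥0∞}
    (hφ : Measurable φ) :
    (intensity ψ g x).withDensity φ = intensity ψ (fun p => g p * φ (x p)) x := by
  rw [intensity, withDensity_map _ hx hφ, ← withDensity_mul _ hg (by fun_prop)]
  rfl

variable [Countable ι]

instance [SFinite ψ] : SFinite (intensity ψ g x) := by
  unfold intensity; infer_instance

theorem intensity_smul (c : ℝ≥0∞) : intensity (c • ψ) g x = c • intensity ψ g x := by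
  rw [intensity, Measure.prod_smul_left, withDensity_smul_measure, Measure.map_smul, intensity]

theorem intensity_withDensity {z : Ω → ℝ≥0∞} (hz : Measurable z) (hg : Measurable g) :
    intensity (ψ.withDensity z) g x = intensity ψ (fun p => z p.1 * g p) x := by
  rw [intensity, prod_withDensity_left hz, ← withDensity_mul _ (by fun_prop) hg]
  rfl

variable [MeasurableSingletonClass ι]

theorem measurable_apply : Measurable fun p : (ι → E) × ι => p.1 p.2 :=
  measurable_from_prod_countable_left measurable_pi_apply

theorem lintegral_prod_count {f : Ω × ι → ℝ≥0∞} (hf : Measurable f) :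
    ∫⁻ p, f p ∂ψ.prod Measure.count = ∫⁻ u, ∑' i, f (u, i) ∂ψ := by
  simp_rw [lintegral_prod _ hf.aemeasurable, lintegral_count]

theorem lintegral_intensity (hg : Measurable g) (hx : Measurable x) {f : E → ℝ≥0∞}
    (hf : Measurable f) :
    ∫⁻ e, f e ∂intensity ψ g x = ∫⁻ u, ∑' i, g (u, i) * f (x (u, i)) ∂ψ := by
  rw [intensity, lintegral_map hf hx, lintegral_withDensity_eq_lintegral_mul _ hg (by fun_prop),
    lintegral_prod_count ψ (by fun_prop)]
  rfl

theorem intensity_univ (hg : Measurable g) (hx : Measurable x)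
    (hsum : ∀ u, ∑' i, g (u, i) = 1) : intensity ψ g x Set.univ = ψ Set.univ := by
  rw [← lintegral_one, lintegral_intensity ψ hg hx measurable_const]
  simp only [mul_one, hsum, lintegral_one]

theorem prod_intensity {Ω' ι' : Type*} [MeasurableSpace Ω'] [MeasurableSpace ι'] [Countable ι']
    [MeasurableSingletonClass ι'] (ψ' : Measure Ω') [SFinite ψ'] {g' : Ω' × ι' → ℝ≥0∞}
    {x' : Ω' × ι' → F} (hg : Measurable g) (hx : Measurable x) (hg' : Measurable g')
    (hx' : Measurable x') :
    (intensity ψ g x).prod (intensity ψ' g' x') =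
      intensity (ψ.prod ψ')
        (fun p : (Ω × Ω') × ι × ι' => g (p.1.1, p.2.1) * g' (p.1.2, p.2.2))
        (fun p => (x (p.1.1, p.2.1), x' (p.1.2, p.2.2))) := by
  refine Measure.ext_of_lintegral _ fun f hf => ?_
  rw [lintegral_prod _ hf.aemeasurable, lintegral_intensity ψ hg hx hf.lintegral_prod_right',
    lintegral_intensity _ (by fun_prop) (by fun_prop) hf, lintegral_prod _ (by fun_prop)]
  refine lintegral_congr fun u => ?_
  simp_rw [ENNReal.tsum_prod', mul_assoc, ENNReal.tsum_mul_left]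
  rw [lintegral_tsum fun i => by fun_prop]
  refine tsum_congr fun i => ?_
  rw [lintegral_const_mul _ (by fun_prop), lintegral_intensity ψ' hg' hx' (by fun_prop)]

end Intensity

section Resampling

variable {Ω ι κ E : Type*} [MeasurableSpace Ω] [MeasurableSpace ι] [MeasurableSpace κ]
  [MeasurableSpace E] [MeasurableSingletonClass ι] [MeasurableSingletonClass κ]
  [Fintype ι] [Fintype κ] [Nonempty κ]

theorem intensity_resample (ψ : Measure Ω) {z : Ω → ℝ≥0∞} (hz : Measurable z) {W : Ω × ι → ℝ≥0∞}
    (hW : Measurable W) (hsum : ∀ u, ∑ i, W (u, i) = 1) {x : Ω × ι → E}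
    (hx : Measurable x) :
    intensity ((ψ.prod (Measure.count : Measure (κ → ι))).withDensity
        fun v => ∏ n, W (v.1, v.2 n))
      (fun p : (Ω × (κ → ι)) × κ => z p.1.1 * (Fintype.card κ : ℝ≥0∞)⁻¹)
      (fun p => x (p.1.1, p.1.2 p.2)) =
    intensity ψ (fun p => z p.1 * W p) x := by
  classical
  have hx' : Measurable fun p : (Ω × (κ → ι)) × κ => x (p.1.1, p.1.2 p.2) :=
    measurable_from_prod_countable_left fun n => by dsimp only; fun_prop
  refine Measure.ext_of_lintegral _ fun f hf => ?_
  have hdens : Measurable fun v : Ω × (κ → ι) => ∏ n, W (v.1, v.2 n) := by fun_prop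
  rw [intensity_withDensity _ hdens (by fun_prop), lintegral_intensity _ (by fun_prop) hx' hf,
    lintegral_intensity ψ (by fun_prop) hx hf, lintegral_prod_count ψ (by dsimp only; fun_prop)]
  refine lintegral_congr fun u => ?_
  simp_rw [tsum_fintype, mul_assoc, ← Finset.mul_sum, mul_left_comm _ (z u), ← Finset.mul_sum]
  rw [sum_prod_mul_average (hsum u) fun i => f (x (u, i))]

theorem intensity_pi (q : Measure E) [IsProbabilityMeasure q] {w : E → ℝ≥0∞}
    (hw : Measurable w) :
    intensity (Measure.pi fun _ : κ => q) (fun p => (Fintype.card κ : ℝ≥0∞)⁻¹ * w (p.1 p.2))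
      (fun p => p.1 p.2) = q.withDensity w := by
  refine Measure.ext_of_lintegral _ fun f hf => ?_
  have hg : Measurable fun p : (κ → E) × κ => (Fintype.card κ : ℝ≥0∞)⁻¹ * w (p.1 p.2) :=
    measurable_const.mul (hw.comp measurable_apply)
  have hmarginal (n : κ) : ∫⁻ v : κ → E, w (v n) * f (v n) ∂Measure.pi (fun _ => q) =
      ∫⁻ y, w y * f y ∂q :=
    (measurePreserving_eval (fun _ : κ => q) n).lintegral_comp (hw.mul hf)
  rw [lintegral_intensity _ hg measurable_apply hf, lintegral_withDensity_eq_lintegral_mul _ hw hf]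
  simp_rw [tsum_fintype, mul_assoc, ← Finset.mul_sum]
  rw [lintegral_const_mul _ (by fun_prop), lintegral_finsetSum _ fun n _ => by fun_prop]
  simp only [hmarginal, Finset.sum_const, Finset.card_univ, nsmul_eq_mul, Pi.mul_apply]
  exact ENNReal.inv_mul_cancel_left (by simp) (by simp)

end Resampling

section Paths

variable {X : Type*}

/-- Concatenation of the trajectories `x_{a:c}` and `y_{c+1:b}`. -/
def concat {a c b : ℕ} (x : Path X a c) (y : Path X (c + 1) b) : Path X a b :=
  fun k => if hk : (k : ℕ) ≤ c then x ⟨k, k.2.1, hk⟩ else y ⟨k, not_le.1 hk, k.2.2⟩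

theorem concat_appendState {a c b : ℕ} (hcb : c + 1 ≤ b) (x : Path X a c) (y : Path X (c + 1) b)
    (z : X) : concat x (appendState (y, z)) = appendState (concat x y, z) := by
  funext k
  simp only [concat, appendState]
  split_ifs <;> first | rfl | omega

theorem prod_coe_Icc_succ {R : Type*} [CommMonoid R] {a b : ℕ} (hab : a ≤ b + 1)
    (f : Set.Icc a (b + 1) → R) :
    ∏ k, f k = (∏ k : Set.Icc a b, f ⟨k, k.2.1, k.2.2.trans b.le_succ⟩) *
      f ⟨b + 1, hab, le_rfl⟩ := by
  rw [← Finset.prod_erase_mul Finset.univ f (Finset.mem_univ ⟨b + 1, hab, le_rfl⟩)]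
  congr 1
  have hlt {k : Set.Icc a (b + 1)} (hk : k ∈ Finset.univ.erase ⟨b + 1, hab, le_rfl⟩) :
      (k : ℕ) ≤ b :=
    Nat.le_of_lt_succ (lt_of_le_of_ne k.2.2 fun h => (Finset.mem_erase.1 hk).1 (Subtype.ext h))
  refine Finset.prod_bij' (fun k hk => ⟨k, k.2.1, hlt hk⟩)
    (fun k _ => ⟨k, k.2.1, k.2.2.trans b.le_succ⟩) ?_ ?_ ?_ ?_ ?_
  · exact fun _ _ => Finset.mem_univ _
  · refine fun k _ => Finset.mem_erase.2 ⟨fun h => ?_, Finset.mem_univ _⟩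
    exact absurd (congrArg Subtype.val h) (Nat.lt_succ_of_le k.2.2).ne
  all_goals exact fun _ _ => rfl

variable [MeasurableSpace X]

@[fun_prop]
theorem measurable_concat {a c b : ℕ} :
    Measurable fun p : Path X a c × Path X (c + 1) b => concat p.1 p.2 := by
  refine measurable_pi_lambda _ fun k => ?_
  unfold concat
  split_ifs <;> fun_prop

@[fun_prop]
theorem measurable_appendState {a b : ℕ} :
    Measurable (appendState : Path X a b × X → Path X a (b + 1)) := by
  refine measurable_pi_lambda _ fun k => ?_
  unfold appendState
  split_ifs <;> fun_prop

end Paths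

section PartialSmoothing

variable {X : Type*} [MeasurableSpace X] {T : ℕ} (M : Model X T)

instance (a b : ℕ) : SFinite (markovLaw M a b) := by
  have := M.prob_ν a
  induction b with
  | zero => unfold markovLaw; infer_instance
  | succ b _ => unfold markovLaw; split_ifs <;> infer_instance

instance (a b : ℕ) : SFinite (unnormSmoothing M a b) := by
  unfold unnormSmoothing; infer_instance

theorem measurable_potential (a b : ℕ) : Measurable fun x : Path X a b =>
    ∏ k : Set.Icc a b, if a < (k : ℕ) then (M.h k (x k) : ℝ≥0∞) else 1 := by
  refine Finset.measurable_prod _ fun k _ => ?_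
  have := M.measurable_h k
  split_ifs <;> fun_prop

theorem markovLaw_self (a : ℕ) : markovLaw M a a = (M.ν a).map fun x _ => x := by
  cases a with
  | zero => rfl
  | succ a => rw [markovLaw, dif_neg a.not_succ_le_self]

theorem unnormSmoothing_self (a : ℕ) :
    unnormSmoothing M a a = (M.ν a).map fun x _ => x := by
  have hpot : (fun x : Path X a a =>
      ∏ k : Set.Icc a a, if a < (k : ℕ) then (M.h k (x k) : ℝ≥0∞) else 1) = 1 :=
    funext fun x => Finset.prod_eq_one fun k _ => if_neg (not_lt.2 k.2.2)
  rw [unnormSmoothing, hpot, withDensity_one, markovLaw_self]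

theorem potential_appendState {a b : ℕ} (hab : a ≤ b) (x : Path X a b) (y : X) :
    (∏ k : Set.Icc a (b + 1),
      if a < (k : ℕ) then (M.h k (appendState (x, y) k) : ℝ≥0∞) else 1) =
      (∏ k : Set.Icc a b, if a < (k : ℕ) then (M.h k (x k) : ℝ≥0∞) else 1) *
        M.h (b + 1) y := by
  rw [prod_coe_Icc_succ (hab.trans b.le_succ)]
  congr 1
  · refine Finset.prod_congr rfl fun k _ => ?_
    rw [appendState, dif_pos k.2.2]
  · rw [if_pos (Nat.lt_succ_of_le hab), appendState, dif_neg b.not_succ_le_self]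

/-- The kernel `P_t(dx_t | x_{t-1}) h_t(x_t)`: one step of the model, weighted by its potential. -/
def Model.weightedKernel (t : ℕ) : Kernel X X :=
  have := M.markov_P t
  (M.P t).withDensity fun _ y => M.h t y

theorem measurable_uncurry_h (t : ℕ) :
    Measurable (Function.uncurry fun _ y : X => (M.h t y : ℝ≥0∞)) :=
  ((M.measurable_h t).comp measurable_snd).coe_nnreal_ennreal

theorem weightedKernel_apply (t : ℕ) (x : X) :
    M.weightedKernel t x = (M.P t x).withDensity fun y => M.h t y :=
  have := M.markov_P t
  Kernel.withDensity_apply _ (measurable_uncurry_h M t) x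

theorem lintegral_weightedKernel (t : ℕ) (x : X) {f : X → ℝ≥0∞} (hf : Measurable f) :
    ∫⁻ y, f y ∂M.weightedKernel t x = ∫⁻ y, M.h t y * f y ∂M.P t x :=
  have := M.markov_P t
  Kernel.lintegral_withDensity _ (measurable_uncurry_h M t) x hf

instance (t : ℕ) : IsSFiniteKernel (M.weightedKernel t) :=
  have := M.markov_P t
  inferInstanceAs (IsSFiniteKernel ((M.P t).withDensity fun _ y => M.h t y))

theorem measurable_lintegral_appendState {a b : ℕ} (hab : a ≤ b) {f : Path X a (b + 1) → ℝ≥0∞}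
    (hf : Measurable f) : Measurable fun x : Path X a b =>
      ∫⁻ y, f (appendState (x, y)) ∂M.weightedKernel (b + 1) (x ⟨b, hab, le_rfl⟩) :=
  (hf.comp measurable_appendState).lintegral_kernel_prod_right'
    (κ := (M.weightedKernel (b + 1)).comap (fun x : Path X a b => x ⟨b, hab, le_rfl⟩)
      (measurable_pi_apply _))

theorem lintegral_unnormSmoothing_succ {a b : ℕ} (hab : a ≤ b) {f : Path X a (b + 1) → ℝ≥0∞}
    (hf : Measurable f) :
    ∫⁻ x, f x ∂unnormSmoothing M a (b + 1) =
      ∫⁻ x, ∫⁻ y, f (appendState (x, y)) ∂M.weightedKernel (b + 1) (x ⟨b, hab, le_rfl⟩)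
        ∂unnormSmoothing M a b := by
  have := M.markov_P (b + 1)
  have hpot := measurable_potential M a (b + 1)
  rw [unnormSmoothing, lintegral_withDensity_eq_lintegral_mul _ hpot hf, markovLaw, dif_pos hab,
    lintegral_map (hpot.mul hf) measurable_appendState, Measure.lintegral_compProd
      (f := fun p => (_ * f) (appendState p)) ((hpot.mul hf).comp measurable_appendState),
    unnormSmoothing, lintegral_withDensity_eq_lintegral_mul _ (measurable_potential M a b)
      (measurable_lintegral_appendState M hab hf)]
  refine lintegral_congr fun x => ?_
  have hh := M.measurable_h (b + 1)
  rw [Pi.mul_apply, lintegral_weightedKernel M _ _ (by fun_prop),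
    ← lintegral_const_mul _ (by fun_prop)]
  refine lintegral_congr fun y => ?_
  rw [Pi.mul_apply, potential_appendState M hab, mul_assoc]

theorem isProbabilityMeasure_smoothing {a b : ℕ} (hL_pos : 0 < normConst M a b)
    (hL_fin : normConst M a b < ∞) : IsProbabilityMeasure (smoothing M a b) :=
  ⟨ENNReal.inv_mul_cancel hL_pos.ne' hL_fin.ne⟩

end PartialSmoothing

section Stitching

variable {X : Type*} [MeasurableSpace X] {T : ℕ} {M : Model X T} (S : Sampler M)

theorem withDensity_w {t : ℕ} (ht : t ≤ T) :
    (S.q t).withDensity (fun x => (S.w t x : ℝ≥0∞)) = M.ν t := by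
  have := S.prob_q t
  have := M.prob_ν t
  rw [withDensity_congr_ae (S.w_ae t ht), Measure.withDensity_rnDeriv_eq _ _ (S.ac t ht)]

theorem withDensity_ω {t : ℕ} (ht : 0 < t) (htT : t ≤ T) (x : X) :
    (M.ν t).withDensity (fun y => (S.ω t x y : ℝ≥0∞)) = M.weightedKernel t x := by
  have := M.markov_P t
  have := M.prob_ν t
  have : SigmaFinite ((M.P t x).withDensity fun y => (M.h t y : ℝ≥0∞)) :=
    SigmaFinite.withDensity_of_ne_top' (by simp)
  have hac : (M.P t x).withDensity (fun y => (M.h t y : ℝ≥0∞)) ≪ M.ν t :=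
    (withDensity_absolutelyContinuous _ _).trans (M.ac t ht htT x)
  rw [weightedKernel_apply, withDensity_congr_ae (S.ω_ae t ht htT x),
    Measure.withDensity_rnDeriv_eq _ _ hac]

@[fun_prop]
theorem measurable_ω_comp {Ω : Type*} [MeasurableSpace Ω] (t : ℕ) {f g : Ω → X}
    (hf : Measurable f) (hg : Measurable g) : Measurable fun v => S.ω t (f v) (g v) :=
  (S.measurable_ω t).comp (hf.prodMk hg)

/-- Joins measures on the trajectories `x_{a:c}` and `y_{c+1:b}` into one on the trajectories
`x_{a:b}`, with density `ω_{c+1}(x_c, y_{c+1})` relative to their product. -/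
def stitch {a c b : ℕ} (hac : a ≤ c) (hcb : c + 1 ≤ b) (μ : Measure (Path X a c))
    (μ' : Measure (Path X (c + 1) b)) : Measure (Path X a b) :=
  ((μ.prod μ').withDensity fun p =>
    (S.ω (c + 1) (p.1 ⟨c, hac, le_rfl⟩) (p.2 ⟨c + 1, le_rfl, hcb⟩) : ℝ≥0∞)).map
      fun p => concat p.1 p.2

theorem lintegral_stitch {a c b : ℕ} (hac : a ≤ c) (hcb : c + 1 ≤ b) (μ : Measure (Path X a c))
    (μ' : Measure (Path X (c + 1) b)) [SFinite μ'] {f : Path X a b → ℝ≥0∞} (hf : Measurable f) :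
    ∫⁻ x, f x ∂stitch S hac hcb μ μ' =
      ∫⁻ x, ∫⁻ y, S.ω (c + 1) (x ⟨c, hac, le_rfl⟩) (y ⟨c + 1, le_rfl, hcb⟩) * f (concat x y)
        ∂μ' ∂μ := by
  rw [stitch, lintegral_map hf measurable_concat,
    lintegral_withDensity_eq_lintegral_mul _ (by fun_prop) (by fun_prop),
    lintegral_prod _ (by fun_prop)]
  rfl

theorem stitch_unnormSmoothing {a c b : ℕ} (hac : a ≤ c) (hcb : c + 1 ≤ b) (hb : b ≤ T) :
    stitch S hac hcb (unnormSmoothing M a c) (unnormSmoothing M (c + 1) b) =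
      unnormSmoothing M a b := by
  refine Measure.ext_of_lintegral _ fun f hf => ?_
  rw [lintegral_stitch S hac hcb _ _ hf]
  induction b, hcb using Nat.le_induction with
  | base =>
    rw [lintegral_unnormSmoothing_succ M hac hf, unnormSmoothing_self M (c + 1)]
    refine lintegral_congr fun x => ?_
    rw [lintegral_map (by fun_prop) (by fun_prop), ← withDensity_ω S c.succ_pos hb,
      lintegral_withDensity_eq_lintegral_mul _ (by fun_prop) (by fun_prop)]
    rfl
  | succ b hcb ih =>
    have hab : a ≤ b := hac.trans (c.le_succ.trans hcb)
    rw [lintegral_unnormSmoothing_succ M hab hf,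
      ← ih (b.le_succ.trans hb) _ (measurable_lintegral_appendState M hab hf)]
    refine lintegral_congr fun x => ?_
    rw [lintegral_unnormSmoothing_succ M hcb (by fun_prop)]
    refine lintegral_congr fun y => ?_
    have hlast : concat x y ⟨b, hab, le_rfl⟩ = y ⟨b, hcb, le_rfl⟩ := dif_neg (not_le.2 hcb)
    rw [hlast, ← lintegral_const_mul _ (by fun_prop)]
    refine lintegral_congr fun z => ?_
    have hfirst : appendState (y, z) ⟨c + 1, le_rfl, hcb.trans b.le_succ⟩ =
        y ⟨c + 1, le_rfl, hcb⟩ := dif_pos hcb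
    rw [hfirst, concat_appendState hcb]

end Stitching

section Trajectories

variable {X : Type*} {N : ℕ} {a c b : ℕ}

theorem traj_node (l : SplitTree a c) (r : SplitTree (c + 1) b) (u : Vars X N l × Vars X N r)
    (s : Fin N → Fin N × Fin N) (n : Fin N) :
    traj (.node l r) (u, s) n = starTraj l r (u, s n) := by
  funext k
  simp only [traj, particle, sigma, starTraj]
  split_ifs <;> rfl

theorem starTraj_eq_concat (l : SplitTree a c) (r : SplitTree (c + 1) b)
    (p : (Vars X N l × Vars X N r) × Fin N × Fin N) :
    starTraj l r p = concat (traj l p.1.1 p.2.1) (traj r p.1.2 p.2.2) := rfl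

variable [MeasurableSpace X]

@[fun_prop]
theorem measurable_traj (t : SplitTree a b) :
    Measurable fun p : Vars X N t × Fin N => traj t p.1 p.2 := by
  induction t with
  | leaf a => exact measurable_pi_lambda _ fun _ => measurable_apply (E := X)
  | @node a c b l r hl hr =>
    have hstar : Measurable fun p : ((Vars X N l × Vars X N r) × (Fin N → Fin N × Fin N)) × Fin N =>
        starTraj l r (p.1.1, p.1.2 p.2) :=
      measurable_from_prod_countable_left fun n => by
        simp only [starTraj_eq_concat]
        fun_prop
    simp_rw [← traj_node l r] at hstar
    exact hstar

@[fun_prop]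
theorem measurable_starTraj (l : SplitTree a c) (r : SplitTree (c + 1) b) :
    Measurable (starTraj l r : (Vars X N l × Vars X N r) × Fin N × Fin N → Path X a b) := by
  simp only [funext (starTraj_eq_concat l r)]
  fun_prop

end Trajectories

section Algorithm

variable {X : Type*} [MeasurableSpace X] {T : ℕ} {M : Model X T} (S : Sampler M) {N : ℕ}
  {a c b : ℕ}

@[fun_prop]
theorem measurable_weight (t : SplitTree a b) :
    Measurable fun p : Vars X N t × Fin N => weight S t p.1 p.2 := by
  cases t with
  | leaf =>
    have hw := S.measurable_w a
    exact measurable_from_prod_countable_left fun n =>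
      (measurable_normalizeWeights n).comp (f := fun (v : Fin N → X) m => S.w a (v m))
        (by fun_prop)
  | node l r => exact measurable_const

@[fun_prop]
theorem measurable_stitchWeight (l : SplitTree a c) (r : SplitTree (c + 1) b) :
    Measurable fun p : (Vars X N l × Vars X N r) × Fin N × Fin N => stitchWeight S l r p.1 p.2 := by
  unfold stitchWeight
  fun_prop

@[fun_prop]
theorem measurable_weightMatrix (l : SplitTree a c) (r : SplitTree (c + 1) b) :
    Measurable fun p : (Vars X N l × Vars X N r) × Fin N × Fin N => weightMatrix S l r p.1 p.2 :=
  measurable_from_prod_countable_left fun mn =>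
    (measurable_normalizeWeights mn).comp (f := stitchWeight S l r) (by fun_prop)

@[fun_prop]
theorem measurable_normEst (t : SplitTree a b) :
    Measurable fun v : Vars X N t => normEst S t v := by
  induction t with
  | leaf a =>
    have hw := S.measurable_w a
    have hsum : Measurable fun v : Fin N → X => (N : ℝ≥0)⁻¹ * ∑ n, S.w a (v n) := by fun_prop
    exact hsum
  | @node a c b l r hl hr =>
    have hroot : Measurable fun v : (Vars X N l × Vars X N r) × (Fin N → Fin N × Fin N) =>
        normEst S l v.1.1 * normEst S r v.1.2 * ∑ mn, stitchWeight S l r v.1 mn := by fun_prop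
    exact hroot

@[fun_prop]
theorem measurable_rootNormEst (l : SplitTree a c) (r : SplitTree (c + 1) b) :
    Measurable fun v : Vars X N l × Vars X N r => rootNormEst S l r v := by
  unfold rootNormEst
  fun_prop

instance (t : SplitTree a b) : SFinite (psi S t : Measure (Vars X N t)) := by
  induction t with
  | leaf k =>
    have := S.prob_q k
    exact inferInstanceAs (SFinite (Measure.pi fun _ : Fin N => S.q k))
  | @node a c b l r hl hr =>
    exact inferInstanceAs (SFinite ((((psi S l).prod (psi S r)).prod
      (Measure.count : Measure (Fin N → Fin N × Fin N))).withDensity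
        fun v => ∏ n, (weightMatrix S l r v.1 (v.2 n) : ℝ≥0∞)))

theorem sum_weightMatrix [NeZero N] (l : SplitTree a c) (r : SplitTree (c + 1) b)
    (u : Vars X N l × Vars X N r) : ∑ mn, (weightMatrix S l r u mn : ℝ≥0∞) = 1 := by
  exact_mod_cast sum_normalizeWeights (stitchWeight S l r u)

theorem rootNormEst_mul_weightMatrix (l : SplitTree a c) (r : SplitTree (c + 1) b)
    (u : Vars X N l × Vars X N r) (mn : Fin N × Fin N) :
    rootNormEst S l r u * weightMatrix S l r u mn =
      normEst S l u.1 * normEst S r u.2 * stitchWeight S l r u mn := by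
  rw [rootNormEst, weightMatrix, mul_assoc, sum_mul_normalizeWeights]

/-- The intensity of the weighted trajectories that dSMC returns on a tree, rescaled by the estimate
of the normalizing constant. -/
def treeIntensity (N : ℕ) (t : SplitTree a b) : Measure (Path X a b) :=
  intensity (psi S t) (fun p : Vars X N t × Fin N => (normEst S t p.1 : ℝ≥0∞) * weight S t p.1 p.2)
    fun p => traj t p.1 p.2

/-- The intensity of the weighted star trajectories at the root, before the index pair is drawn,
rescaled by the estimate of the normalizing constant. -/
def rootIntensity (N : ℕ) (l : SplitTree a c) (r : SplitTree (c + 1) b) : Measure (Path X a b) :=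
  intensity ((psi S l).prod (psi S r))
    (fun p : (Vars X N l × Vars X N r) × Fin N × Fin N =>
      (rootNormEst S l r p.1 : ℝ≥0∞) * weightMatrix S l r p.1 p.2)
    (starTraj l r)

theorem rootIntensity_eq_stitch (l : SplitTree a c) (r : SplitTree (c + 1) b) :
    rootIntensity S N l r = stitch S l.le r.le (treeIntensity S N l) (treeIntensity S N r) := by
  rw [stitch, treeIntensity, treeIntensity, prod_intensity _ _ (by fun_prop) (by fun_prop)
    (by fun_prop) (by fun_prop), withDensity_intensity _ (by fun_prop) (by fun_prop)
    (by fun_prop), map_intensity _ (by fun_prop) measurable_concat, rootIntensity]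
  congr 1
  funext p
  rw [← ENNReal.coe_mul, rootNormEst_mul_weightMatrix, stitchWeight]
  push_cast
  ring

theorem treeIntensity_leaf [NeZero N] {k : ℕ} (hk : k ≤ T) :
    treeIntensity S N (.leaf k) = unnormSmoothing M k k := by
  have := S.prob_q k
  have hw := (S.measurable_w k).coe_nnreal_ennreal
  have hweight (v : Fin N → X) (n : Fin N) :
      (normEst S (.leaf k) v : ℝ≥0∞) * weight S (.leaf k) v n =
        (Fintype.card (Fin N) : ℝ≥0∞)⁻¹ * S.w k (v n) := by
    simp only [normEst, weight]
    rw [← ENNReal.coe_mul, mul_assoc,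
      sum_mul_normalizeWeights fun m => S.w k (v m), ENNReal.coe_mul,
      ENNReal.coe_inv (NeZero.ne _), ENNReal.coe_natCast, Fintype.card_fin]
  rw [unnormSmoothing_self, ← withDensity_w S hk, ← intensity_pi (κ := Fin N) (S.q k) hw,
    map_intensity _ measurable_apply (by fun_prop)]
  exact congrArg (fun g => intensity (Measure.pi fun _ : Fin N => S.q k) g fun p _ => p.1 p.2)
    (funext fun p => hweight p.1 p.2)

theorem treeIntensity_node [NeZero N] (l : SplitTree a c) (r : SplitTree (c + 1) b) :
    treeIntensity S N (.node l r) = rootIntensity S N l r := by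
  have hweight (v : Vars X N (.node l r)) (n : Fin N) :
      (weight S (.node l r) v n : ℝ≥0∞) = (Fintype.card (Fin N) : ℝ≥0∞)⁻¹ := by
    rw [weight, ENNReal.coe_inv (NeZero.ne _), ENNReal.coe_natCast, Fintype.card_fin]
  rw [rootIntensity, ← intensity_resample (κ := Fin N) ((psi S l).prod (psi S r))
    (z := fun u => rootNormEst S l r u)
    (W := fun p => weightMatrix S l r p.1 p.2) (by fun_prop) (by fun_prop)
    (sum_weightMatrix S l r) (measurable_starTraj l r)]
  simp_rw [treeIntensity, hweight, ← traj_node]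
  rfl

theorem treeIntensity_eq_unnormSmoothing [NeZero N] (t : SplitTree a b) (hb : b ≤ T) :
    treeIntensity S N t = unnormSmoothing M a b := by
  induction t with
  | leaf k => exact treeIntensity_leaf S hb
  | node l r hl hr =>
    rw [treeIntensity_node, rootIntensity_eq_stitch, hl ((Nat.le_succ _).trans (r.le.trans hb)),
      hr hb, stitch_unnormSmoothing S _ _ hb]

theorem rootIntensity_eq_unnormSmoothing [NeZero N] (l : SplitTree a c)
    (r : SplitTree (c + 1) b) (hb : b ≤ T) :
    rootIntensity S N l r = unnormSmoothing M a b := by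
  rw [← treeIntensity_node, treeIntensity_eq_unnormSmoothing S _ hb]

theorem extendedTarget_eq_smul (l : SplitTree a c) (r : SplitTree (c + 1) b) :
    extendedTarget S N l r = (normConst M a b)⁻¹ •
      ((psi S l).prod (psi S r)).withDensity fun u => (rootNormEst S l r u : ℝ≥0∞) := by
  simp_rw [extendedTarget, ENNReal.div_eq_inv_mul]
  exact withDensity_smul _ (by fun_prop)

theorem map_starLaw [NeZero N] (l : SplitTree a c) (r : SplitTree (c + 1) b) (hb : b ≤ T) :
    (starLaw S N l r).map (starTraj l r) = smoothing M a b := by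
  change intensity (extendedTarget S N l r) (fun p => (weightMatrix S l r p.1 p.2 : ℝ≥0∞)) _ = _
  rw [extendedTarget_eq_smul, intensity_smul, intensity_withDensity _ (by fun_prop) (by fun_prop),
    smoothing, ← rootIntensity_eq_unnormSmoothing S (N := N) l r hb, rootIntensity]

theorem map_starLaw_univ [NeZero N] (l : SplitTree a c) (r : SplitTree (c + 1) b) :
    (starLaw S N l r).map (starTraj l r) Set.univ = extendedTarget S N l r Set.univ :=
  intensity_univ _ (by fun_prop) (measurable_starTraj l r) fun u =>
    (tsum_fintype _).trans (sum_weightMatrix S l r u)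

end Algorithm

end DSMC

end

theorem mainTheorem3 {X : Type*} [MeasurableSpace X] {T : ℕ} (M : Model X T) (S : Sampler M)
    (N : ℕ) (hN : 0 < N) {a c b : ℕ} (hb : b ≤ T)
    (hL_pos : 0 < normConst M a b) (hL_fin : normConst M a b < ∞)
    (l : SplitTree a c) (r : SplitTree (c + 1) b) :
    IsProbabilityMeasure (extendedTarget S N l r) ∧
      IsProbabilityMeasure (smoothing M a b) ∧
      (starLaw S N l r).map (starTraj l r) = smoothing M a b := by
  have : NeZero N := ⟨hN.ne'⟩
  have hQ := isProbabilityMeasure_smoothing M hL_pos hL_fin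
  have hstar := map_starLaw S (N := N) l r hb
  have hπ : IsProbabilityMeasure (extendedTarget S N l r) :=
    ⟨by rw [← map_starLaw_univ, hstar, measure_univ]⟩
  exact ⟨hπ, hQ, hstar⟩
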